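/- Let $\Omega\subset\mathbb R^2$ be open, $\omega\subset\Omega$ measurable, $T,\nu,\mu,\lambda_0>0$, let $\lambda(\mathbf x)=\lambda_0$ for $\mathbf x\in\Omega\setminus\omega$ and $\lambda(\mathbf x)=0$ for $\mathbf x\in\omega$, and let $u_0\in L^2(\Omega)$. Consider on $(0,T)\times\Omega$ the problem $$\partial_t u=\Delta\big(-\nu\arctan(\Delta u)|\nabla u|-\mu\Delta u\big)+\lambda(u_0-u),\qquad u|_{t=0}=u_0,\qquad u=\frac{\partial u}{\partial\vec n}=0\ \text{ on }\partial\Omega .$$ Let $\mathcal T$ be the set of all $\varphi\in \mathrm{Lip}([0,T];H^2(\Omega))$ with $\varphi(t,\cdot)=\partial_{\vec n}\varphi(t,\cdot)=0$ on $\partial\Omega$, i.e. $\varphi(t,\cdot)\in H^2_0(\Omega)$ (the closure of $C_c^\infty(\Omega)$ in $H^2(\Omega)$), for all $t\in[0,T]$. Let $\sigma\in\{-1,1\}$. A function $u\in L^2((0,T);H^2(\Omega))$ is called an admissible solution (with sign $\sigma$) if the following two conditions hold. (i) There is $\pi\in L^1_w([0,T]\times\Omega;\mathcal M(\mathbb R))$,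 i.e. a weakly measurable map $(t,\mathbf x)\mapsto\pi_{(t,\mathbf x)}$ into the finite signed Borel measures on $\mathbb R$ with integrable total variation, such that $\int_{\mathbb R}\arctan(\xi)\,d\pi_{(t,\mathbf x)}(\xi)$ is essentially bounded on $[0,T]\times\Omega$ and, for every $\varphi\in\mathcal T$ with $\varphi(T,\cdot)=0$, $$\int_0^T\!\!\int_\Omega u\,\partial_t\varphi\,d\mathbf x\,dt+\int_\Omega u_0\,\varphi(0,\mathbf x)\,d\mathbf x=\int_0^T\!\!\int_\Omega\Big(\nu\int_{\mathbb R}\arctan(\xi)\,d\pi_{(t,\mathbf x)}(\xi)\,|\nabla u|+\mu\Delta u\Big)\Delta\varphi\,d\mathbf x\,dt-\int_0^T\!\!\int_\Omega\lambda(u_0-u)\varphi\,d\mathbf x\,dt .$$ (ii) For every $\varphi\in\mathcal T$ and almost every $t\in[0,T]$, $$\int_\Omega\tfrac12\big(u(t,\mathbf x)-\varphi(t,\mathbf x)\big)^2d\mathbf x-\int_\Omega\tfrac12\big(u_0(\mathbf x)-\varphi(0,\mathbf x)\big)^2d\mathbf x+\int_0^t\!\!\int_\Omega(u-\varphi)\,\partial_t\varphi\,d\mathbf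 x\,dt'$$ $$\le\ \sigma\int_0^t\!\!\int_\Omega\Big(\nu\arctan(\Delta\varphi)\,|\nabla u|\,\Delta(u-\varphi)+\mu\,\Delta\varphi\,\Delta(u-\varphi)\Big)d\mathbf x\,dt'+\int_0^t\!\!\int_\Omega\lambda(u_0-u)(u-\varphi)\,d\mathbf x\,dt' .$$ (Formally testing the equation with $u-\varphi$ gives (ii) with $\sigma=-1$; the result holds for either sign.) **Theorem.** For either choice of $\sigma$, every admissible solution $u$ attains its initial datum strongly in $L^2(\Omega)$: $$\operatorname*{ess\,lim}_{t\to0}\int_\Omega|u(t,\mathbf x)-u_0(\mathbf x)|^2\,d\mathbf x=0 .$$ -/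

import Mathlib

open MeasureTheory Set Filter Topology
open scoped ContDiff NNReal ZeroAtInfty

noncomputable section

namespace ShockFilter

/-- The plane `ℝ²` with its Euclidean norm. -/
abbrev Plane : Type := EuclideanSpace ℝ (Fin 2)

/-- The `i`-th partial derivative of a (smooth) function on the plane. -/
def partialDeriv (i : Fin 2) (ψ : Plane → ℝ) (x : Plane) : ℝ :=
  fderiv ℝ ψ x (EuclideanSpace.single i 1)

/-- `ψ ∈ C_c^∞(Ω)`. -/
structure IsTestFunction (Ω : Set Plane) (ψ : Plane → ℝ) : Prop where
  smooth : ContDiff ℝ ∞ ψ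
  compact : HasCompactSupport ψ
  support : tsupport ψ ⊆ Ω

/-- The space `L²(Ω)`. -/
abbrev L2 (Ω : Set Plane) : Type := Lp ℝ 2 (volume.restrict Ω)

/-- `g ∈ L²(Ω)` is the weak partial derivative `∂ᵢ f` of `f ∈ L²(Ω)` in `Ω`. -/
def IsWeakPartial (Ω : Set Plane) (i : Fin 2) (f g : L2 Ω) : Prop :=
  ∀ ψ : Plane → ℝ, IsTestFunction Ω ψ →
    ∫ x in Ω, f x * partialDeriv i ψ x = -∫ x in Ω, g x * ψ x

/-- Indices for a function (`inl ()`), its two first order partial derivatives (`inr (inl i)`) and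
its four second order partial derivatives (`inr (inr (i, j))`). -/
abbrev JetIndex : Type := Unit ⊕ (Fin 2 ⊕ Fin 2 × Fin 2)

/-- Families of `L²(Ω)` functions indexed by `JetIndex`, with the Hilbert norm
`(∑ₖ ‖Jₖ‖²)^(1/2)`. -/
abbrev Jet (Ω : Set Plane) : Type := PiLp 2 (fun _ : JetIndex => L2 Ω)

theorem IsTestFunction.memLp {Ω : Set Plane} {ψ : Plane → ℝ} (h : IsTestFunction Ω ψ) :
    MemLp ψ 2 (volume.restrict Ω) :=
  (h.smooth.continuous.memLp_of_hasCompactSupport h.compact).restrict Ω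

theorem IsTestFunction.memLp_partialDeriv {Ω : Set Plane} {ψ : Plane → ℝ}
    (h : IsTestFunction Ω ψ) (i : Fin 2) :
    MemLp (partialDeriv i ψ) 2 (volume.restrict Ω) := by
  have hc : Continuous (partialDeriv i ψ) :=
    (h.smooth.continuous_fderiv (by simp)).clm_apply continuous_const
  have hs : HasCompactSupport (partialDeriv i ψ) :=
    h.compact.fderiv_apply (𝕜 := ℝ) (EuclideanSpace.single i 1)
  exact (hc.memLp_of_hasCompactSupport hs).restrict Ω

theorem IsWeakPartial.zero (Ω : Set Plane) (i : Fin 2) : IsWeakPartial Ω i 0 0 := by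
  intro ψ _
  have h0 : ∀ h : Plane → ℝ, ∫ x in Ω, (0 : L2 Ω) x * h x = 0 := by
    intro h
    apply integral_eq_zero_of_ae
    filter_upwards [Lp.coeFn_zero ℝ 2 (volume.restrict Ω)] with x hx
    rw [hx]
    simp
  rw [h0, h0, neg_zero]

theorem IsWeakPartial.add {Ω : Set Plane} {i : Fin 2} {f g f' g' : L2 Ω}
    (h : IsWeakPartial Ω i f g) (h' : IsWeakPartial Ω i f' g') :
    IsWeakPartial Ω i (f + f') (g + g') := by
  intro ψ hψ
  have key : ∀ (a b : L2 Ω) (q : Plane → ℝ), MemLp q 2 (volume.restrict Ω) →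
      ∫ x in Ω, (a + b : L2 Ω) x * q x = (∫ x in Ω, a x * q x) + ∫ x in Ω, b x * q x := by
    intro a b q hq
    have ha : Integrable (fun x => a x * q x) (volume.restrict Ω) :=
      (Lp.memLp a).integrable_mul hq
    have hb : Integrable (fun x => b x * q x) (volume.restrict Ω) :=
      (Lp.memLp b).integrable_mul hq
    rw [← integral_add ha hb]
    apply integral_congr_ae
    filter_upwards [Lp.coeFn_add a b] with x hx
    rw [hx, Pi.add_apply, add_mul]
  rw [key _ _ _ (hψ.memLp_partialDeriv i), key _ _ _ hψ.memLp, h ψ hψ, h' ψ hψ]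
  ring

theorem IsWeakPartial.smul {Ω : Set Plane} {i : Fin 2} {f g : L2 Ω} (c : ℝ)
    (h : IsWeakPartial Ω i f g) : IsWeakPartial Ω i (c • f) (c • g) := by
  intro ψ hψ
  have key : ∀ (a : L2 Ω) (q : Plane → ℝ),
      ∫ x in Ω, (c • a : L2 Ω) x * q x = c * ∫ x in Ω, a x * q x := by
    intro a q
    rw [← integral_const_mul]
    apply integral_congr_ae
    filter_upwards [Lp.coeFn_smul c a] with x hx
    simp [hx, mul_assoc]
  rw [key, key, h ψ hψ]
  ring

/-- The Sobolev space `H²(Ω)` with its Hilbert norm: an element is a function in `L²(Ω)` together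
with its (uniquely determined) weak partial derivatives of order one and two, all in `L²(Ω)`. -/
def H2 (Ω : Set Plane) : Submodule ℝ (Jet Ω) where
  carrier := {J | (∀ i, IsWeakPartial Ω i (J (.inl ())) (J (.inr (.inl i)))) ∧
    ∀ i j, IsWeakPartial Ω j (J (.inr (.inl i))) (J (.inr (.inr (i, j))))}
  zero_mem' := ⟨fun i => IsWeakPartial.zero Ω i, fun _ j => IsWeakPartial.zero Ω j⟩
  add_mem' := fun h h' =>
    ⟨fun i => (h.1 i).add (h'.1 i), fun i j => (h.2 i j).add (h'.2 i j)⟩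
  smul_mem' := fun c _ h => ⟨fun i => (h.1 i).smul c, fun i j => (h.2 i j).smul c⟩

/-- The function underlying an element of `H²(Ω)`. -/
def val {Ω : Set Plane} (v : H2 Ω) (x : Plane) : ℝ := (v : Jet Ω) (.inl ()) x

/-- `|∇v|`. -/
def gradNorm {Ω : Set Plane} (v : H2 Ω) (x : Plane) : ℝ :=
  Real.sqrt (∑ i : Fin 2, ((v : Jet Ω) (.inr (.inl i)) x) ^ 2)

/-- `Δv`. -/
def lap {Ω : Set Plane} (v : H2 Ω) (x : Plane) : ℝ :=
  ∑ i : Fin 2, (v : Jet Ω) (.inr (.inr (i, i))) x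

/-- The space `H²₀(Ω)` of the functions in `H²(Ω)` with `v = ∂v/∂n = 0` on `∂Ω`: the closure of
`C_c^∞(Ω)` in the norm of `H²(Ω)`. -/
def H20 (Ω : Set Plane) : Set (H2 Ω) :=
  closure {v : H2 Ω | ∃ ψ : Plane → ℝ, IsTestFunction Ω ψ ∧ val v =ᵐ[volume.restrict Ω] ψ}

/-- The class `Lip([0,T]; H²(Ω))` with the boundary conditions `φ = ∂φ/∂n = 0` on
`[0,T] × ∂Ω`. -/
structure IsLipTest (Ω : Set Plane) (T : ℝ) (φ : ℝ → H2 Ω) : Prop where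
  lip : ∃ K : ℝ≥0, LipschitzOnWith K φ (Icc 0 T)
  boundary : ∀ t ∈ Icc 0 T, φ t ∈ H20 Ω

/-- The fidelity coefficient: `lam₀` outside the inpainting domain `D` and `0` in `D`. -/
def fidelity (lam₀ : ℝ) (D : Set Plane) : Plane → ℝ := Dᶜ.indicator fun _ => lam₀

/-- `∫_ℝ arctan ξ dπ(ξ)`. -/
def arctanMean (π : SignedMeasure ℝ) : ℝ := ∫ᵛ ξ, Real.arctan ξ ∂•π

/-- `π ∈ L¹_w([0,T] × Ω; 𝓜(ℝ))`: a weakly measurable map into the finite signed Borel measures on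
`ℝ` (the dual of `C₀(ℝ)`) whose total variation is integrable. -/
structure IsWeakL1 (Ω : Set Plane) (T : ℝ) (π : ℝ × Plane → SignedMeasure ℝ) : Prop where
  measurable : ∀ f : C₀(ℝ, ℝ), AEMeasurable (fun p => ∫ᵛ ξ, f ξ ∂•(π p))
    (volume.restrict (Ioo 0 T ×ˢ Ω))
  integrable : ∫⁻ p in Ioo 0 T ×ˢ Ω, (π p).totalVariation univ < ⊤

/-- The pair `(u, π)` is a Young measure solution on `(0,T) × Ω`, with initial datum `u₀`, of
`∂ₜu = Δ(-ν arctan(Δu)|∇u| - μ Δu) + λ(u₀ - u)`, `u = ∂u/∂n = 0` on the boundary. The boundary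
conditions are encoded in the weak formulation. -/
structure IsYoungSolution (Ω D : Set Plane) (T ν μ lam₀ : ℝ) (u₀ : L2 Ω) (u : ℝ → H2 Ω)
    (π : ℝ × Plane → SignedMeasure ℝ) : Prop where
  memLp : MemLp u 2 (volume.restrict (Ioo 0 T))
  weakL1 : IsWeakL1 Ω T π
  weak : ∀ φ : ℝ → H2 Ω, IsLipTest Ω T φ → φ T = 0 →
    (∫ t in 0..T, ∫ x in Ω, val (u t) x * val (deriv φ t) x) + ∫ x in Ω, u₀ x * val (φ 0) x =
      (∫ t in 0..T, ∫ x in Ω,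
        (ν * arctanMean (π (t, x)) * gradNorm (u t) x + μ * lap (u t) x) * lap (φ t) x) -
      ∫ t in 0..T, ∫ x in Ω, fidelity lam₀ D x * (u₀ x - val (u t) x) * val (φ t) x
  bounded : ∃ c : ℝ, ∀ᵐ p ∂(volume.restrict (Ioo 0 T ×ˢ Ω)), |arctanMean (π p)| ≤ c

/-- Admissible solutions: Young measure solutions that satisfy the entropy inequality for all
test functions. The parameter `σ` is the sign of the second order terms on the right-hand
side; `σ = -1` is the sign obtained by formally testing the equation with `u - φ`. -/
structure IsAdmissible (σ : ℝ) (Ω D : Set Plane) (T ν μ lam₀ : ℝ) (u₀ : L2 Ω) (u : ℝ → H2 Ω) :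
    Prop where
  solution : ∃ π : ℝ × Plane → SignedMeasure ℝ, IsYoungSolution Ω D T ν μ lam₀ u₀ u π
  entropy : ∀ φ : ℝ → H2 Ω, IsLipTest Ω T φ → ∀ᵐ t ∂(volume.restrict (Ioo 0 T)),
    (∫ x in Ω, 1 / 2 * (val (u t) x - val (φ t) x) ^ 2) -
        (∫ x in Ω, 1 / 2 * (u₀ x - val (φ 0) x) ^ 2) +
        (∫ s in 0..t, ∫ x in Ω, (val (u s) x - val (φ s) x) * val (deriv φ s) x) ≤
      σ * (∫ s in 0..t, ∫ x in Ω,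
        (ν * Real.arctan (lap (φ s) x) * gradNorm (u s) x * lap (u s - φ s) x +
          μ * lap (φ s) x * lap (u s - φ s) x)) +
      ∫ s in 0..t, ∫ x in Ω,
        fidelity lam₀ D x * (u₀ x - val (u s) x) * (val (u s) x - val (φ s) x)

/-- `ess lim_{t → 0} f(t) = l` for a function `f` on `(0,T)`: the limit holds off a null set. -/
def EssLimAtZero (T : ℝ) (f : ℝ → ℝ) (l : ℝ) : Prop :=
  ∃ N : Set ℝ, volume N = 0 ∧ Tendsto f (𝓝[Ioo 0 T \ N] 0) (𝓝 l)

end ShockFilter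

end

noncomputable section

namespace ShockFilter

variable {Ω : Set Plane}

/-! Test the entropy inequality with a time-independent `w ∈ H20 Ω`: the `∂ₜφ` term drops out, and
`‖u(t) - w‖² ≤ ‖u₀ - w‖²` holds in `L²` up to time integrals over `(0,t)`. As `arctan` is bounded
and `u ∈ L²((0,T); H²)`, their integrands have integrable majorants, so they vanish as `t → 0`; only
absolute values enter, so the sign `σ` is irrelevant (`IsAdmissible.exists_bound`). Since `C_c^∞(Ω)`
is dense in `L²(Ω)` (`dense_testSubmodule`), `w` can be taken close to `u₀`, and the triangle
inequality concludes. A sequence of such `w` suffices, so the exceptional null sets of times can be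
united. -/

/-! ### Test functions as elements of `H²₀(Ω)`. -/

theorem IsTestFunction.partialDeriv {ψ : Plane → ℝ} (h : IsTestFunction Ω ψ) (i : Fin 2) :
    IsTestFunction Ω (partialDeriv i ψ) where
  smooth := by
    unfold ShockFilter.partialDeriv
    exact (h.smooth.fderiv_right (m := ∞) (by simp)).clm_apply contDiff_const
  compact := h.compact.fderiv_apply (𝕜 := ℝ) (EuclideanSpace.single i 1)
  support := (tsupport_fderiv_apply_subset ℝ _).trans h.support

/-- Integration by parts for test functions. -/
theorem IsTestFunction.setIntegral_mul_partialDeriv {f g : Plane → ℝ} (hf : IsTestFunction Ω f)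
    (hg : IsTestFunction Ω g) (i : Fin 2) :
    ∫ x in Ω, f x * ShockFilter.partialDeriv i g x =
      -∫ x in Ω, ShockFilter.partialDeriv i f x * g x := by
  have hz : ∀ x, x ∉ Ω → g x = 0 := fun x hx =>
    image_eq_zero_of_notMem_tsupport fun h => hx (hg.support h)
  have hz' : ∀ x, x ∉ Ω → f x = 0 := fun x hx =>
    image_eq_zero_of_notMem_tsupport fun h => hx (hf.support h)
  rw [setIntegral_eq_integral_of_forall_compl_eq_zero (fun x hx => by simp [hz' x hx]),
    setIntegral_eq_integral_of_forall_compl_eq_zero (fun x hx => by simp [hz x hx])]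
  have hi : ∀ {a b : Plane → ℝ}, IsTestFunction Ω a → IsTestFunction Ω b →
      Integrable (fun x => a x * b x) := fun ha hb =>
    (ha.smooth.continuous.mul hb.smooth.continuous).integrable_of_hasCompactSupport
      ha.compact.mul_right
  exact integral_mul_fderiv_eq_neg_fderiv_mul_of_integrable
    (hi (hf.partialDeriv i) hg) (hi hf (hg.partialDeriv i)) (hi hf hg)
    (fun x _ => (hf.smooth.differentiable (by simp)).differentiableAt)
    (fun x _ => (hg.smooth.differentiable (by simp)).differentiableAt)

theorem IsTestFunction.isWeakPartial {f : Plane → ℝ} (hf : IsTestFunction Ω f) (i : Fin 2) :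
    IsWeakPartial Ω i (hf.memLp.toLp f) ((hf.partialDeriv i).memLp.toLp _) := by
  intro ψ hψ
  have h₁ : ∫ x in Ω, hf.memLp.toLp f x * ShockFilter.partialDeriv i ψ x =
      ∫ x in Ω, f x * ShockFilter.partialDeriv i ψ x := by
    refine integral_congr_ae ?_
    filter_upwards [hf.memLp.coeFn_toLp] with x hx
    rw [hx]
  have h₂ : ∫ x in Ω, (hf.partialDeriv i).memLp.toLp _ x * ψ x =
      ∫ x in Ω, ShockFilter.partialDeriv i f x * ψ x := by
    refine integral_congr_ae ?_
    filter_upwards [(hf.partialDeriv i).memLp.coeFn_toLp] with x hx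
    rw [hx]
  rw [h₁, h₂, hf.setIntegral_mul_partialDeriv hψ i]

/-- A test function as an element of `H²(Ω)`. -/
def IsTestFunction.toH2 {f : Plane → ℝ} (hf : IsTestFunction Ω f) : H2 Ω :=
  ⟨WithLp.toLp 2 fun k => match k with
    | .inl () => hf.memLp.toLp f
    | .inr (.inl i) => (hf.partialDeriv i).memLp.toLp _
    | .inr (.inr (i, j)) => ((hf.partialDeriv i).partialDeriv j).memLp.toLp _,
    fun i => hf.isWeakPartial i, fun i j => (hf.partialDeriv i).isWeakPartial j⟩

/-- The `L²(Ω)` function underlying an element of `H²(Ω)`. -/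
def toL2 (v : H2 Ω) : L2 Ω := (v : Jet Ω) (.inl ())

theorem IsTestFunction.toL2_toH2 {f : Plane → ℝ} (hf : IsTestFunction Ω f) :
    toL2 hf.toH2 = hf.memLp.toLp f := rfl

theorem IsTestFunction.toH2_mem_H20 {f : Plane → ℝ} (hf : IsTestFunction Ω f) :
    hf.toH2 ∈ H20 Ω :=
  subset_closure ⟨f, hf, hf.memLp.coeFn_toLp⟩

theorem isLipTest_const (T : ℝ) {v : H2 Ω} (hv : v ∈ H20 Ω) : IsLipTest Ω T fun _ => v where
  lip := ⟨0, (LipschitzWith.const v).lipschitzOnWith⟩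
  boundary := fun _ _ => hv

/-! ### Density of test functions in `L²(Ω)`. -/

variable (Ω) in
/-- The test functions as a subspace of `L²(Ω)`. -/
def testSubmodule : Submodule ℝ (L2 Ω) where
  carrier := {f | ∃ ψ : Plane → ℝ, ∃ h : IsTestFunction Ω ψ, f = h.memLp.toLp ψ}
  zero_mem' := by
    have h : IsTestFunction Ω 0 :=
      ⟨contDiff_const, HasCompactSupport.zero, by simp [tsupport]⟩
    exact ⟨0, h, (MemLp.toLp_zero _).symm⟩
  add_mem' := by
    rintro _ _ ⟨ψ, h, rfl⟩ ⟨ψ', h', rfl⟩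
    have h'' : IsTestFunction Ω (ψ + ψ') :=
      ⟨h.smooth.add h'.smooth, h.compact.add h'.compact,
        (tsupport_add ψ ψ').trans (union_subset h.support h'.support)⟩
    exact ⟨_, h'', (MemLp.toLp_add h.memLp h'.memLp).symm⟩
  smul_mem' := by
    rintro c _ ⟨ψ, h, rfl⟩
    have h' : IsTestFunction Ω (c • ψ) :=
      ⟨h.smooth.const_smul c, h.compact.smul_left (f := fun _ => c),
        (tsupport_smul_subset_right (fun _ => c) ψ).trans h.support⟩
    exact ⟨_, h', (MemLp.toLp_const_smul c h.memLp).symm⟩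

/-- `C_c^∞(Ω)` is dense in `L²(Ω)`. -/
theorem dense_testSubmodule (hΩ : IsOpen Ω) : Dense (testSubmodule Ω : Set (L2 Ω)) := by
  rw [Submodule.dense_iff_topologicalClosure_eq_top, Submodule.topologicalClosure_eq_top_iff,
    Submodule.eq_bot_iff]
  intro f hf
  -- Fundamental lemma of the calculus of variations: `f` is orthogonal to every test function.
  have key : ∀ᵐ x, x ∈ Ω → f x = 0 := by
    refine hΩ.ae_eq_zero_of_integral_contDiff_smul_eq_zero ?_ fun g hg hc hs => ?_
    · exact locallyIntegrableOn_of_locallyIntegrable_restrict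
        ((Lp.memLp f).locallyIntegrable (by norm_num))
    · have hgt : IsTestFunction Ω g := ⟨hg, hc, hs⟩
      have h0 := (Submodule.mem_orthogonal _ _).1 hf _ ⟨g, hgt, rfl⟩
      rw [L2.inner_def] at h0
      rw [← setIntegral_eq_integral_of_forall_compl_eq_zero (s := Ω) fun x hx => by
        simp [image_eq_zero_of_notMem_tsupport fun h => hx (hs h)], ← h0]
      refine integral_congr_ae ?_
      filter_upwards [hgt.memLp.coeFn_toLp] with x hx
      simp [hx, mul_comm]
  rw [Lp.eq_zero_iff_ae_eq_zero]
  exact (ae_restrict_iff' hΩ.measurableSet).2 key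

/-! ### Pointwise and integral bounds by the `H²` norm. -/

theorem integrable_sq (f : L2 Ω) : Integrable (fun x => f x ^ 2) (volume.restrict Ω) :=
  (Lp.memLp f).integrable_sq

theorem integral_sq (f : L2 Ω) : ∫ x in Ω, f x ^ 2 = ‖f‖ ^ 2 := by
  rw [← real_inner_self_eq_norm_sq, L2.inner_def]
  exact integral_congr_ae (ae_of_all _ fun x => by simp [sq])

theorem integral_sub_sq (f g : L2 Ω) : ∫ x in Ω, (f x - g x) ^ 2 = ‖f - g‖ ^ 2 := by
  rw [← integral_sq]
  refine integral_congr_ae ?_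
  filter_upwards [Lp.coeFn_sub f g] with x hx
  rw [hx, Pi.sub_apply]

/-- The sum of the squares of `v` and of its derivatives of order at most two. -/
def jetSq (v : H2 Ω) (x : Plane) : ℝ := ∑ k, (v : Jet Ω) k x ^ 2

theorem integrable_jetSq (v : H2 Ω) : Integrable (jetSq v) (volume.restrict Ω) :=
  integrable_finsetSum _ fun k _ => integrable_sq ((v : Jet Ω) k)

theorem integral_jetSq (v : H2 Ω) : ∫ x in Ω, jetSq v x = ‖v‖ ^ 2 := by
  have h : ‖v‖ ^ 2 = ∑ k, ‖(v : Jet Ω) k‖ ^ 2 := PiLp.norm_sq_eq_of_L2 _ (v : Jet Ω)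
  simp only [h, jetSq]
  rw [integral_finsetSum _ fun k _ => integrable_sq ((v : Jet Ω) k)]
  exact Finset.sum_congr rfl fun k _ => integral_sq _

theorem jetSq_eq (v : H2 Ω) (x : Plane) :
    jetSq v x = val v x ^ 2 + (∑ i, (v : Jet Ω) (.inr (.inl i)) x ^ 2 +
      ∑ p : Fin 2 × Fin 2, (v : Jet Ω) (.inr (.inr p)) x ^ 2) := by
  simp [jetSq, val, Fintype.sum_sum_type]

theorem val_sq_le_jetSq (v : H2 Ω) (x : Plane) : val v x ^ 2 ≤ jetSq v x := by
  rw [jetSq_eq]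
  exact le_add_of_nonneg_right (by positivity)

theorem gradNorm_sq_le_jetSq (v : H2 Ω) (x : Plane) : gradNorm v x ^ 2 ≤ jetSq v x := by
  rw [jetSq_eq, gradNorm, Real.sq_sqrt (by positivity)]
  have : 0 ≤ ∑ p : Fin 2 × Fin 2, (v : Jet Ω) (.inr (.inr p)) x ^ 2 := by positivity
  nlinarith [sq_nonneg (val v x)]

/-- The factor 2 comes from `(a + b)² ≤ 2(a² + b²)` for the two pure second derivatives. -/
theorem lap_sq_le_jetSq (v : H2 Ω) (x : Plane) : lap v x ^ 2 ≤ 2 * jetSq v x := by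
  have h : 0 ≤ ∑ i, (v : Jet Ω) (.inr (.inl i)) x ^ 2 := by positivity
  rw [jetSq_eq, lap, Fintype.sum_prod_type]
  simp only [Fin.sum_univ_two] at h ⊢
  nlinarith [sq_nonneg (val v x),
    sq_nonneg ((v : Jet Ω) (.inr (.inr (0, 0))) x - (v : Jet Ω) (.inr (.inr (1, 1))) x),
    sq_nonneg ((v : Jet Ω) (.inr (.inr (0, 1))) x), sq_nonneg ((v : Jet Ω) (.inr (.inr (1, 0))) x)]

/-- Bound for the second order terms of the entropy inequality. -/
theorem abs_integral_diffusion_le {ν μ : ℝ} (hν : 0 ≤ ν) (hμ : 0 ≤ μ) (v w : H2 Ω) :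
    |∫ x in Ω, (ν * Real.arctan (lap w x) * gradNorm v x * lap (v - w) x +
      μ * lap w x * lap (v - w) x)| ≤ (2 * ν + μ) * (5 * ‖v‖ ^ 2 + 6 * ‖w‖ ^ 2) := by
  have hv := integrable_jetSq v
  have hd := integrable_jetSq (v - w)
  have hw := integrable_jetSq w
  have hi : Integrable (fun x => (2 * ν + μ) * (jetSq v x + 2 * jetSq (v - w) x + 2 * jetSq w x))
      (volume.restrict Ω) :=
    ((hv.add (hd.const_mul 2)).add (hw.const_mul 2)).const_mul _
  have hn : ‖v - w‖ ^ 2 ≤ 2 * ‖v‖ ^ 2 + 2 * ‖w‖ ^ 2 := by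
    have := norm_sub_le v w
    nlinarith [sq_nonneg (‖v‖ - ‖w‖), norm_nonneg (v - w), norm_nonneg v, norm_nonneg w]
  calc _ ≤ ∫ x in Ω, (2 * ν + μ) * (jetSq v x + 2 * jetSq (v - w) x + 2 * jetSq w x) := by
        refine norm_integral_le_of_norm_le (f := fun x => ν * Real.arctan (lap w x) *
          gradNorm v x * lap (v - w) x + μ * lap w x * lap (v - w) x) hi (ae_of_all _ fun x => ?_)
        have h1 := gradNorm_sq_le_jetSq v x
        have h2 := lap_sq_le_jetSq (v - w) x
        have h3 := lap_sq_le_jetSq w x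
        -- `π/2 ≤ 2`, a convenient integer bound.
        have ha : |Real.arctan (lap w x)| ≤ 2 := by
          have := Real.pi_le_four
          exact abs_le.2 ⟨by linarith [Real.neg_pi_div_two_lt_arctan (lap w x)],
            by linarith [Real.arctan_lt_pi_div_two (lap w x)]⟩
        set g := gradNorm v x
        set l := lap (v - w) x
        set p := lap w x
        have hgl : |g * l| ≤ g ^ 2 + l ^ 2 :=
          abs_le.2 ⟨by nlinarith [sq_nonneg (g + l)], by nlinarith [sq_nonneg (g - l)]⟩
        have hpl : |p * l| ≤ p ^ 2 + l ^ 2 :=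
          abs_le.2 ⟨by nlinarith [sq_nonneg (p + l)], by nlinarith [sq_nonneg (p - l)]⟩
        calc ‖ν * Real.arctan p * g * l + μ * p * l‖
            = |ν * (Real.arctan p * (g * l)) + μ * (p * l)| := by
              rw [Real.norm_eq_abs]; congr 1; ring
          _ ≤ ν * (|Real.arctan p| * |g * l|) + μ * |p * l| := by
              refine (abs_add_le _ _).trans_eq ?_
              rw [abs_mul, abs_mul μ, abs_mul (Real.arctan p), abs_of_nonneg hν, abs_of_nonneg hμ]
          _ ≤ ν * (2 * (g ^ 2 + l ^ 2)) + μ * (p ^ 2 + l ^ 2) := by gcongr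
          _ ≤ (2 * ν + μ) * (g ^ 2 + l ^ 2 + p ^ 2) := by
              nlinarith [mul_nonneg hν (sq_nonneg p), mul_nonneg hμ (sq_nonneg g)]
          _ ≤ _ := by gcongr
    _ = (2 * ν + μ) * (‖v‖ ^ 2 + 2 * ‖v - w‖ ^ 2 + 2 * ‖w‖ ^ 2) := by
        have hs : Integrable (fun x => jetSq v x + 2 * jetSq (v - w) x) (volume.restrict Ω) :=
          hv.add (hd.const_mul 2)
        rw [integral_const_mul, integral_add hs (hw.const_mul 2),
          integral_add hv (hd.const_mul 2), integral_const_mul, integral_const_mul,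
          integral_jetSq, integral_jetSq, integral_jetSq]
    -- By `hn`, `5 = 1 + 2·2` and `6 = 2·2 + 2`.
    _ ≤ (2 * ν + μ) * (5 * ‖v‖ ^ 2 + 6 * ‖w‖ ^ 2) := by
        exact mul_le_mul_of_nonneg_left (by linarith) (by positivity)

/-- Bound for the fidelity term of the entropy inequality. -/
theorem abs_integral_fidelity_le {lam₀ : ℝ} (hlam₀ : 0 ≤ lam₀) (D : Set Plane) (u₀ : L2 Ω)
    (v w : H2 Ω) :
    |∫ x in Ω, fidelity lam₀ D x * (u₀ x - val v x) * (val v x - val w x)| ≤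
      lam₀ * (‖u₀‖ ^ 2 + 2 * ‖v‖ ^ 2 + ‖w‖ ^ 2) := by
  have h₀ := integrable_sq u₀
  have hv := integrable_jetSq v
  have hw := integrable_jetSq w
  calc _ ≤ ∫ x in Ω, lam₀ * (u₀ x ^ 2 + 2 * jetSq v x + jetSq w x) := by
        refine norm_integral_le_of_norm_le (f := fun x => fidelity lam₀ D x *
          (u₀ x - val v x) * (val v x - val w x)) (((h₀.add (hv.const_mul 2)).add hw).const_mul _)
          (ae_of_all _ fun x => ?_)
        have h1 := val_sq_le_jetSq v x
        have h2 := val_sq_le_jetSq w x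
        have hf : |fidelity lam₀ D x| ≤ lam₀ := by
          unfold fidelity
          by_cases hx : x ∈ Dᶜ <;> simp [hx, abs_of_nonneg hlam₀, hlam₀]
        set a := u₀ x
        set b := val v x
        set c := val w x
        -- From `|xy| ≤ (x² + y²)/2` with `x² ≤ 2a² + 2b²` and `y² ≤ 2b² + 2c²`.
        have hab : |(a - b) * (b - c)| ≤ a ^ 2 + 2 * b ^ 2 + c ^ 2 :=
          abs_le.2 ⟨by nlinarith [sq_nonneg (a - b + (b - c)), sq_nonneg (a + b), sq_nonneg (b + c)],
            by nlinarith [sq_nonneg (a - b - (b - c)), sq_nonneg (a + b), sq_nonneg (b + c)]⟩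
        rw [Real.norm_eq_abs, mul_assoc, abs_mul]
        calc _ ≤ lam₀ * (a ^ 2 + 2 * b ^ 2 + c ^ 2) := by gcongr
          _ ≤ _ := by gcongr
    _ = _ := by
        have hs : Integrable (fun x => u₀ x ^ 2 + 2 * jetSq v x) (volume.restrict Ω) :=
          h₀.add (hv.const_mul 2)
        rw [integral_const_mul, integral_add hs hw,
          integral_add h₀ (hv.const_mul 2), integral_const_mul, integral_sq, integral_jetSq,
          integral_jetSq]

/-- Only the majorant must be integrable: if `F` is not, its integral is 0 by convention and the
bound still holds. -/
theorem abs_intervalIntegral_le {T t : ℝ} (ht : t ∈ Ioo 0 T) {F G : ℝ → ℝ}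
    (hG : IntegrableOn G (Ioo 0 T)) (h : ∀ s, |F s| ≤ G s) :
    |∫ s in 0..t, F s| ≤ ∫ s in 0..t, G s := by
  refine intervalIntegral.norm_integral_le_of_norm_le (f := F) ht.1.le (ae_of_all _ fun s _ => h s) ?_
  rw [intervalIntegrable_iff_integrableOn_Ioc_of_le ht.1.le]
  exact hG.mono_set (Ioc_subset_Ioo_right ht.2)

/-! ### Entropy inequality and the initial trace. -/

/-- The entropy inequality for the time independent test function `w` bounds the distance of `u`
to `w` by its initial value, up to an error that vanishes as `t → 0`. -/
theorem IsAdmissible.exists_bound {σ T ν μ lam₀ : ℝ} {D : Set Plane} {u₀ : L2 Ω} {u : ℝ → H2 Ω}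
    (hσ : σ = -1 ∨ σ = 1) (hν : 0 ≤ ν) (hμ : 0 ≤ μ) (hlam₀ : 0 ≤ lam₀) (hT : 0 < T)
    (hu : IsAdmissible σ Ω D T ν μ lam₀ u₀ u) {w : H2 Ω} (hw : w ∈ H20 Ω) :
    ∃ r : ℝ → ℝ, Tendsto r (𝓝[Ioo 0 T] 0) (𝓝 0) ∧ ∀ᵐ t ∂(volume.restrict (Ioo 0 T)),
      ‖toL2 (u t) - toL2 w‖ ^ 2 ≤ ‖u₀ - toL2 w‖ ^ 2 + r t := by
  obtain ⟨π, hπ⟩ := hu.solution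
  have hsq : IntegrableOn (fun s => ‖u s‖ ^ 2) (Ioo 0 T) := hπ.memLp.norm.integrable_sq
  have hc : ∀ c : ℝ, IntegrableOn (fun _ : ℝ => c) (Ioo 0 T) := fun c =>
    integrableOn_const (by simp)
  have hG₁ : IntegrableOn (fun s => (2 * ν + μ) * (5 * ‖u s‖ ^ 2 + 6 * ‖w‖ ^ 2)) (Ioo 0 T) :=
    ((hsq.const_mul 5).add (hc _)).const_mul _
  have hG₂ : IntegrableOn (fun s => lam₀ * (‖u₀‖ ^ 2 + 2 * ‖u s‖ ^ 2 + ‖w‖ ^ 2)) (Ioo 0 T) :=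
    (((hc _).add (hsq.const_mul 2)).add (hc _)).const_mul _
  -- The primitive of an integrable function is continuous, here at 0.
  have hlim : ∀ {G : ℝ → ℝ}, IntegrableOn G (Ioo 0 T) →
      Tendsto (fun t => ∫ s in 0..t, G s) (𝓝[Ioo 0 T] 0) (𝓝 0) := by
    intro G hG
    have hG' : IntegrableOn G (uIcc 0 T) := by
      rw [uIcc_of_le hT.le, integrableOn_Icc_iff_integrableOn_Ioo]
      exact hG
    have h := intervalIntegral.continuousOn_primitive_interval hG' 0 left_mem_uIcc
    have h' := h.mono_left (nhdsWithin_mono 0 ((Ioo_subset_Icc_self (a := 0) (b := T)).trans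
      Icc_subset_uIcc))
    simpa using h'
  -- The leading 2 clears the factor `1/2` of the entropy.
  refine ⟨fun t => 2 * ((∫ s in 0..t, (2 * ν + μ) * (5 * ‖u s‖ ^ 2 + 6 * ‖w‖ ^ 2)) +
    ∫ s in 0..t, lam₀ * (‖u₀‖ ^ 2 + 2 * ‖u s‖ ^ 2 + ‖w‖ ^ 2)), ?_, ?_⟩
  · simpa using ((hlim hG₁).add (hlim hG₂)).const_mul 2
  · have hmem : ∀ᵐ t ∂(volume.restrict (Ioo (0 : ℝ) T)), t ∈ Ioo (0 : ℝ) T :=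
      ae_restrict_mem measurableSet_Ioo
    filter_upwards [hu.entropy _ (isLipTest_const T hw), hmem] with t ht htT
    have h1 := abs_intervalIntegral_le htT hG₁ fun s => abs_integral_diffusion_le hν hμ (u s) w
    have h2 := abs_intervalIntegral_le htT hG₂ fun s =>
      abs_integral_fidelity_le hlam₀ D u₀ (u s) w
    -- This removes the `∂ₜφ` term; the representative of the zero class is known to vanish only
    -- almost everywhere.
    have hz : ∀ f : Plane → ℝ, ∫ x in Ω, f x * val (0 : H2 Ω) x = 0 := fun f => by
      refine integral_eq_zero_of_ae ?_
      filter_upwards [Lp.coeFn_zero ℝ 2 (volume.restrict Ω)] with x hx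
      have : val (0 : H2 Ω) x = 0 := hx
      simp [this]
    simp only [deriv_const, hz, intervalIntegral.integral_zero, add_zero] at ht
    rw [integral_const_mul, integral_const_mul] at ht
    have e1 : ∫ x in Ω, (val (u t) x - val w x) ^ 2 = ‖toL2 (u t) - toL2 w‖ ^ 2 :=
      integral_sub_sq _ _
    have e2 : ∫ x in Ω, (u₀ x - val w x) ^ 2 = ‖u₀ - toL2 w‖ ^ 2 := integral_sub_sq _ _
    rw [e1, e2] at ht
    have h1' := abs_le.1 h1
    have h2' := abs_le.1 h2
    rcases hσ with rfl | rfl <;> linarith [h1'.1, h1'.2, h2'.2]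

/-- Admissible solutions attain their initial datum strongly in `L²(Ω)`. -/
theorem IsAdmissible.essLimAtZero {σ T ν μ lam₀ : ℝ} {D : Set Plane} {u₀ : L2 Ω} {u : ℝ → H2 Ω}
    (hΩ : IsOpen Ω) (hσ : σ = -1 ∨ σ = 1) (hν : 0 < ν) (hμ : 0 < μ) (hlam₀ : 0 < lam₀)
    (hT : 0 < T) (hu : IsAdmissible σ Ω D T ν μ lam₀ u₀ u) :
    EssLimAtZero T (fun t => ∫ x in Ω, |val (u t) x - u₀ x| ^ 2) 0 := by
  have happrox : ∀ n : ℕ, ∃ w ∈ H20 Ω, ‖u₀ - toL2 w‖ ^ 2 < 1 / ((n : ℝ) + 1) := by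
    intro n
    have hn : 0 < 1 / ((n : ℝ) + 1) := by positivity
    obtain ⟨_, ⟨ψ, h, rfl⟩, hf⟩ := Metric.dense_iff.1 (dense_testSubmodule hΩ) u₀ _
      (Real.sqrt_pos.2 hn) |>.imp fun _ h => h.symm
    refine ⟨h.toH2, h.toH2_mem_H20, ?_⟩
    rw [h.toL2_toH2, ← dist_eq_norm, dist_comm]
    exact (Real.lt_sqrt dist_nonneg).1 (Metric.mem_ball.1 hf)
  choose w hw hwn using happrox
  choose r hr hrn using fun n => hu.exists_bound hσ hν.le hμ.le hlam₀.le hT (hw n)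
  -- The exceptional set collects the times in `(0,T)` at which the bound fails for some `n`; it is
  -- null as a countable union.
  refine ⟨{t | t ∈ Ioo 0 T → ∀ n, ‖toL2 (u t) - toL2 (w n)‖ ^ 2 ≤ ‖u₀ - toL2 (w n)‖ ^ 2 + r n t}ᶜ,
    (ae_restrict_iff' measurableSet_Ioo).1 (ae_all_iff.2 hrn), ?_⟩
  have hE : ∀ t, ∫ x in Ω, |val (u t) x - u₀ x| ^ 2 = ‖toL2 (u t) - u₀‖ ^ 2 := fun t => by
    simp only [sq_abs]
    exact integral_sub_sq (toL2 (u t)) u₀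
  simp only [hE]
  rw [Metric.tendsto_nhds]
  intro ε hε
  -- With `b = ‖u₀ - w n‖`, the final estimate is `‖u - u₀‖² ≤ 2(b² + r) + 2b² = 4b² + 2r < 6ε/8`.
  obtain ⟨n, hn⟩ := exists_nat_one_div_lt (show 0 < ε / 8 by positivity)
  have hrε : ∀ᶠ t in 𝓝[Ioo 0 T] (0 : ℝ), r n t < ε / 8 :=
    (hr n).eventually_lt_const (by positivity)
  filter_upwards [hrε.filter_mono (nhdsWithin_mono 0 sdiff_subset), self_mem_nhdsWithin]
    with t htr ht
  have hb := not_not.1 ht.2 ht.1 n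
  have htri : ‖toL2 (u t) - u₀‖ ≤ ‖toL2 (u t) - toL2 (w n)‖ + ‖u₀ - toL2 (w n)‖ := by
    rw [norm_sub_rev u₀]
    exact norm_sub_le_norm_sub_add_norm_sub _ _ _
  rw [Real.dist_0_eq_abs, abs_of_nonneg (sq_nonneg _)]
  have hw₀ := hwn n
  nlinarith [norm_nonneg (toL2 (u t) - u₀),
    sq_nonneg (‖toL2 (u t) - toL2 (w n)‖ - ‖u₀ - toL2 (w n)‖)]

end ShockFilter

end

theorem mainTheorem4 (σ : ℝ) (hσ : σ = -1 ∨ σ = 1)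
    (Ω D : Set ShockFilter.Plane) (hΩ : IsOpen Ω) (hD : MeasurableSet D) (hDΩ : D ⊆ Ω)
    (T ν μ lam₀ : ℝ) (hT : 0 < T) (hν : 0 < ν) (hμ : 0 < μ) (hlam₀ : 0 < lam₀)
    (u₀ : ShockFilter.L2 Ω) (u : ℝ → ShockFilter.H2 Ω)
    (hu : ShockFilter.IsAdmissible σ Ω D T ν μ lam₀ u₀ u) :
    ShockFilter.EssLimAtZero T
      (fun t => ∫ x in Ω, |ShockFilter.val (u t) x - u₀ x| ^ 2) 0 := 
  hu.essLimAtZero hΩ hσ hν hμ hlam₀ hT
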